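/- For a bounded set $E\subset\mathbb{R}^n$ let $N_E(\epsilon)$ be the smallest positive integer $N$ such that $E$ can be covered by $N$ axis-parallel boxes of side-length at most $\epsilon$. Let $\dim_M E=\limsup_{\epsilon\to0^+}\log N_E(\epsilon)/\log(1/\epsilon)$ be the (upper) Minkowski dimension of $E$ (with $\dim_M E=\infty$ if $E$ is unbounded), and for arbitrary $E\subset\mathbb{R}^n$ let $\dim_P E=\inf\{\sup_{j\in\mathbb{N}}\dim_M E_j : E\subset\bigcup_{j\in\mathbb{N}}E_j\}$ be its packing dimension. For $S\subset\mathbb{R}^2$ let $\mathcal{h}^M(S)$ and $\mathcal{h}^P(S)$ be the infimum of $\dim_M B$, respectively of $\dim_P B$, over all sets $B\subset\mathbb{R}^2$ such that for each $x\in S$ there is an $r>0$ for which $B$ contains the boundary of the axis-parallel square with centre $x$ and side-length $2r$. (1) There is a number $h\in[17/11,\,7/4]$ such that $\mathcal{h}^M(S)=\mathcal{h}^P(S)=h$ for every segment $S=[a,b]\times\{0\}$, $a<b$, of the $x$-axis. (2) $\mathcal{h}^M(S)=\mathcal{h}^P(S)=3/2$ for every segment $S=\{(t,t): a\le t\le b\}$,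 $a<b$, of the line $y=x$. -/

import Mathlib

open Set Filter Topology

noncomputable section

/-- `N_E(ε)`: the smallest positive integer `k` such that `E ⊆ ℝⁿ` can be covered by `k`
axis-parallel boxes of side-length at most `ε` (`⊤` if there is no such `k`). -/
def boxCoveringNumber {n : ℕ} (E : Set (Fin n → ℝ)) (ε : ℝ) : ℕ∞ :=
  ⨅ (k : ℕ) (_ : 0 < k ∧ ∃ l u : Fin k → Fin n → ℝ,
    (∀ j i, u j i - l j i ≤ ε) ∧ E ⊆ ⋃ j, Icc (l j) (u j)), (k : ℕ∞)

/-- The (upper) Minkowski dimension, i.e. the upper box dimension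
`limsup_{ε → 0+} log N_E(ε) / log (1/ε)`; it is `⊤` when `E` is unbounded. -/
def minkowskiDim {n : ℕ} (E : Set (Fin n → ℝ)) : EReal :=
  limsup (fun ε : ℝ =>
    ENNReal.log (boxCoveringNumber E ε : ENNReal) / ((Real.log (1 / ε) : ℝ) : EReal)) (𝓝[>] 0)

/-- The packing dimension, i.e. the modified upper box dimension
`inf { sup_j dim_M (F j) : E ⊆ ⋃ j, F j }`. -/
def packingDim {n : ℕ} (E : Set (Fin n → ℝ)) : EReal :=
  ⨅ (F : ℕ → Set (Fin n → ℝ)) (_ : E ⊆ ⋃ j, F j), ⨆ j, minkowskiDim (F j)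

/-- The boundary of the square `[-1, 1]²`. -/
def unitSquare : Set (Fin 2 → ℝ) := {p | max |p 0| |p 1| = 1}

/-- `B` contains (the boundary of) a nondegenerate axis-parallel square centred at each point
of `S`. -/
def ContainsSquares (S B : Set (Fin 2 → ℝ)) : Prop :=
  ∀ x ∈ S, ∃ r : ℝ, 0 < r ∧ ∀ p ∈ unitSquare, x + r • p ∈ B

/-- The minimal Minkowski dimension of a set containing an axis-parallel square centred at each
point of `S`. -/
def minMinkowskiDim (S : Set (Fin 2 → ℝ)) : EReal :=
  ⨅ (B : Set (Fin 2 → ℝ)) (_ : ContainsSquares S B), minkowskiDim B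

/-- The minimal packing dimension of a set containing an axis-parallel square centred at each
point of `S`. -/
def minPackingDim (S : Set (Fin 2 → ℝ)) : EReal :=
  ⨅ (B : Set (Fin 2 → ℝ)) (_ : ContainsSquares S B), packingDim B

end

/-! The square with centre `(x, c x)` and half-side `r` has vertical sides at abscissae `x ± r` and
horizontal sides at ordinates `c x ± r`. Up to one dimension carried by the sides themselves, the
problem concerns the dimension `t` of sets of reals containing these numbers for every `x` in an
interval.

Reduction: if `packingDim B < s`, then `B` is covered by countably many closed sets with covering
exponent `s`. Baire's theorem, applied on each side and then to the centres, gives one subinterval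
of centres whose right, left and upper sides contain segments over fixed intervals in fixed pieces.
Slicing bounds the side coordinates with exponent `s - 1` (`exists_side_sets_of_packingDim_lt`).
Conversely, coordinate sets of exponent `t` give a union of products with intervals, of exponent `t
+ 1`.

Lower bounds: on `y = x`, the pair `(x + r, x - r)` determines `x`, so `2 * t ≥ 1`. On the axis, the
sum of `x + r` and `-(x - r)` is `2 * r`, also confined to a set of exponent `t`, while their
difference `2 * x` fills an interval; the Katz–Tao inequality gives `11 * t ≥ 6`.

Upper bounds: split the binary digits of `x` into residue classes of places and choose `r` as a
combination in which some classes cancel in each coordinate.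

Independence of the segment: on the axis, the coordinate sets extracted from any `B` can be
reflected, rescaled to any other segment and turned back into a planar set, so the Minkowski value
of one segment is at most the packing value of any other. -/

/-! ### Collision counting and the Katz–Tao inequality. -/

/-- Cauchy–Schwarz: a map into a set with few elements has many collisions. -/
theorem card_sq_le_card_mul_card_collisions {X T : Type*} [DecidableEq X] [DecidableEq T]
    (s : Finset X) (t : Finset T) (f : X → T) (hf : ∀ x ∈ s, f x ∈ t) :
    s.card ^ 2 ≤ t.card * ((s ×ˢ s).filter fun p => f p.1 = f p.2).card := by
  have h1 : s.card = ∑ b ∈ t, (s.filter fun x => f x = b).card :=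
    Finset.card_eq_sum_card_fiberwise hf
  have h2 : ((s ×ˢ s).filter fun p => f p.1 = f p.2).card =
      ∑ b ∈ t, (s.filter fun x => f x = b).card ^ 2 := by
    rw [Finset.card_eq_sum_card_fiberwise (f := fun p : X × X => f p.1) (t := t)]
    · refine Finset.sum_congr rfl fun b _ => ?_
      rw [sq, ← Finset.card_product]
      congr 1
      ext ⟨x, y⟩
      simp only [Finset.mem_filter, Finset.mem_product]
      grind
    · intro p hp
      simp only [Finset.coe_filter, Finset.mem_product, Set.mem_ofPred_eq] at hp
      exact hf _ hp.1.1
  rw [h2]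
  conv_lhs => rw [h1]
  exact_mod_cast sq_sum_le_card_mul_sum_sq

/-- Only a quarter of the elements can lie in fibres of less than a quarter of average size. -/
theorem four_mul_card_small_fibers_le {X T : Type*} [DecidableEq X] [DecidableEq T]
    (s : Finset X) (t : Finset T) (f : X → T) (hf : ∀ x ∈ s, f x ∈ t) :
    4 * (s.filter fun x => 4 * t.card * (s.filter fun y => f y = f x).card < s.card).card
      ≤ s.card := by
  rcases t.eq_empty_or_nonempty with rfl | ht
  · have : s = ∅ := Finset.eq_empty_of_forall_notMem fun x hx => by simpa using hf x hx
    simp [this]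
  set bad := s.filter fun x => 4 * t.card * (s.filter fun y => f y = f x).card < s.card with hbad
  have h1 : bad.card = ∑ b ∈ t, (bad.filter fun x => f x = b).card :=
    Finset.card_eq_sum_card_fiberwise fun x hx => hf x (Finset.mem_filter.1 hx).1
  have h2 : ∀ b ∈ t, 4 * t.card * (bad.filter fun x => f x = b).card ≤ s.card := by
    intro b _
    rcases (bad.filter fun x => f x = b).eq_empty_or_nonempty with h | ⟨x, hx⟩
    · simp [h]
    · have hx' := Finset.mem_filter.1 hx
      have hx2 := (Finset.mem_filter.1 hx'.1).2
      rw [hx'.2] at hx2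
      refine le_trans (Nat.mul_le_mul_left _ (Finset.card_le_card ?_)) hx2.le
      exact Finset.filter_subset_filter _ (Finset.filter_subset _ _)
  have h3 : t.card * (4 * bad.card) ≤ t.card * s.card := by
    calc t.card * (4 * bad.card) = 4 * t.card * bad.card := by ring
      _ = ∑ b ∈ t, 4 * t.card * (bad.filter fun x => f x = b).card := by
        conv_lhs => rw [h1]
        rw [Finset.mul_sum]
      _ ≤ t.card * s.card := by simpa using Finset.sum_le_sum h2
  exact Nat.le_of_mul_le_mul_left h3 ht.card_pos

/-- Three maps into sets with few elements admit many chains `x₁, x₂, x₃, x₄` of elements with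
`f₁ x₁ = f₁ x₂`, `f₂ x₂ = f₂ x₃`, `f₃ x₃ = f₃ x₄`. -/
theorem card_pow_four_le_card_chains {X T₁ T₂ T₃ : Type*} [DecidableEq X] [DecidableEq T₁]
    [DecidableEq T₂] [DecidableEq T₃] (s : Finset X) (t₁ : Finset T₁) (t₂ : Finset T₂)
    (t₃ : Finset T₃) (f₁ : X → T₁) (f₂ : X → T₂) (f₃ : X → T₃) (h₁ : ∀ x ∈ s, f₁ x ∈ t₁)
    (h₂ : ∀ x ∈ s, f₂ x ∈ t₂) (h₃ : ∀ x ∈ s, f₃ x ∈ t₃) :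
    s.card ^ 4 ≤ 64 * (t₁.card * t₂.card * t₃.card) *
      ((s ×ˢ s ×ˢ s ×ˢ s).filter fun q => f₁ q.1 = f₁ q.2.1 ∧ f₂ q.2.1 = f₂ q.2.2.1 ∧
        f₃ q.2.2.1 = f₃ q.2.2.2).card := by
  set Q := (s ×ˢ s ×ˢ s ×ˢ s).filter fun q => f₁ q.1 = f₁ q.2.1 ∧ f₂ q.2.1 = f₂ q.2.2.1 ∧
        f₃ q.2.2.1 = f₃ q.2.2.2
  have hb₁ := four_mul_card_small_fibers_le s t₁ f₁ h₁
  have hb₃ := four_mul_card_small_fibers_le s t₃ f₃ h₃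
  set bad₁ := s.filter fun x => 4 * t₁.card * (s.filter fun y => f₁ y = f₁ x).card < s.card
  set bad₃ := s.filter fun x => 4 * t₃.card * (s.filter fun y => f₃ y = f₃ x).card < s.card
  -- Elements with large fibres under both `f₁` and `f₃` are at least half of `s`. The middle pair
  -- `x₂, x₃` is taken there, so each such pair extends to many choices of `x₁` and `x₄`.
  set good := s.filter fun x => s.card ≤ 4 * t₁.card * (s.filter fun y => f₁ y = f₁ x).card ∧
    s.card ≤ 4 * t₃.card * (s.filter fun y => f₃ y = f₃ x).card with hgood
  have hcov : s ⊆ good ∪ (bad₁ ∪ bad₃) := by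
    intro x hx
    simp only [good, bad₁, bad₃, Finset.mem_union, Finset.mem_filter, hx, true_and]
    omega
  have hg : s.card ≤ 2 * good.card := by
    have := (Finset.card_le_card hcov).trans (Finset.card_union_le _ _)
    have := Finset.card_union_le bad₁ bad₃
    omega
  set P := (good ×ˢ good).filter fun p => f₂ p.1 = f₂ p.2
  have hP : good.card ^ 2 ≤ t₂.card * P.card :=
    card_sq_le_card_mul_card_collisions good t₂ f₂ fun x hx => h₂ x (Finset.mem_filter.1 hx).1
  have hsum : ∑ p ∈ P, (s.filter fun y => f₁ y = f₁ p.1).card *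
      (s.filter fun y => f₃ y = f₃ p.2).card ≤ Q.card := by
    have : ∑ p ∈ P, (s.filter fun y => f₁ y = f₁ p.1).card *
        (s.filter fun y => f₃ y = f₃ p.2).card =
        (P.sigma fun p => (s.filter fun y => f₁ y = f₁ p.1) ×ˢ
          (s.filter fun y => f₃ y = f₃ p.2)).card := by
      simp [Finset.card_sigma]
    rw [this]
    refine Finset.card_le_card_of_injOn (fun z => (z.2.1, z.1.1, z.1.2, z.2.2)) ?_ ?_
    · rintro ⟨⟨x₂, x₃⟩, x₁, x₄⟩ hz
      simp [P, Q, good] at hz ⊢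
      tauto
    · rintro ⟨⟨x₂, x₃⟩, x₁, x₄⟩ _ ⟨⟨y₂, y₃⟩, y₁, y₄⟩ _ h
      simp at h
      obtain ⟨rfl, rfl, rfl, rfl⟩ := h
      rfl
  have hlow : P.card * s.card ^ 2 ≤ 16 * (t₁.card * t₃.card) * Q.card := by
    calc P.card * s.card ^ 2 = ∑ p ∈ P, s.card * s.card := by simp [sq]
      _ ≤ ∑ p ∈ P, (4 * t₁.card * (s.filter fun y => f₁ y = f₁ p.1).card) *
          (4 * t₃.card * (s.filter fun y => f₃ y = f₃ p.2).card) := by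
        refine Finset.sum_le_sum fun p hp => ?_
        have hp' := Finset.mem_product.1 (Finset.mem_filter.1 hp).1
        exact Nat.mul_le_mul (Finset.mem_filter.1 hp'.1).2.1 (Finset.mem_filter.1 hp'.2).2.2
      _ = 16 * (t₁.card * t₃.card) * ∑ p ∈ P, (s.filter fun y => f₁ y = f₁ p.1).card *
          (s.filter fun y => f₃ y = f₃ p.2).card := by
        rw [Finset.mul_sum]
        exact Finset.sum_congr rfl fun p _ => by ring
      _ ≤ _ := Nat.mul_le_mul_left _ hsum
  calc s.card ^ 4 = s.card ^ 2 * s.card ^ 2 := by ring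
    _ ≤ (2 * good.card) ^ 2 * s.card ^ 2 := by gcongr
    _ = 4 * good.card ^ 2 * s.card ^ 2 := by ring
    _ ≤ 4 * (t₂.card * P.card) * s.card ^ 2 := by gcongr
    _ = 4 * t₂.card * (P.card * s.card ^ 2) := by ring
    _ ≤ 4 * t₂.card * (16 * (t₁.card * t₃.card) * Q.card) := by gcongr
    _ = _ := by ring

/-- The Katz–Tao sums-differences inequality with exponent `11/6`. -/
theorem katz_tao_sums_differences (A B C : Finset ℤ) (G : Finset (ℤ × ℤ)) (N : ℕ)
    (hA : A.card ≤ N) (hB : B.card ≤ N) (hC : C.card ≤ N)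
    (hGA : ∀ g ∈ G, g.1 ∈ A) (hGB : ∀ g ∈ G, g.2 ∈ B) (hGC : ∀ g ∈ G, g.1 + g.2 ∈ C)
    (hinj : ∀ g ∈ G, ∀ g' ∈ G, g.1 - g.2 = g'.1 - g'.2 → g = g') :
    G.card ^ 6 ≤ 64 * N ^ 11 := by
  -- Pairs of points of `G` on a common vertical line, written `v = ((a, b), (a, b'))` below.
  set V := (G ×ˢ G).filter fun p => p.1.1 = p.2.1 with hVdef
  have hV : G.card ^ 2 ≤ A.card * V.card := card_sq_le_card_mul_card_collisions G A Prod.fst hGA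
  have hmem : ∀ v ∈ V, v.1 ∈ G ∧ v.2 ∈ G ∧ v.1.1 = v.2.1 := by
    intro v hv
    simpa [V, and_assoc] using hv
  have hch := card_pow_four_le_card_chains V (C ×ˢ C) (B ×ˢ B) (C ×ˢ B)
    (fun v => (v.1.1 + v.1.2, v.2.1 + v.2.2)) (fun v => (v.1.2, v.2.2))
    (fun v => (v.1.1 + v.1.2, v.2.2))
    (fun v hv => Finset.mem_product.2 ⟨hGC _ (hmem v hv).1, hGC _ (hmem v hv).2.1⟩)
    (fun v hv => Finset.mem_product.2 ⟨hGB _ (hmem v hv).1, hGB v.2 (hmem v hv).2.1⟩)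
    (fun v hv => Finset.mem_product.2 ⟨hGC _ (hmem v hv).1, hGB v.2 (hmem v hv).2.1⟩)
  set Q := (V ×ˢ V ×ˢ V ×ˢ V).filter fun q =>
    (q.1.1.1 + q.1.1.2, q.1.2.1 + q.1.2.2) = (q.2.1.1.1 + q.2.1.1.2, q.2.1.2.1 + q.2.1.2.2) ∧
    (q.2.1.1.2, q.2.1.2.2) = (q.2.2.1.1.2, q.2.2.1.2.2) ∧
    (q.2.2.1.1.1 + q.2.2.1.1.2, q.2.2.1.2.2) = (q.2.2.2.1.1 + q.2.2.2.1.2, q.2.2.2.2.2)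
    with hQdef
  -- A chain is determined by `v₁`, `a₃` and `b₄`. The difference `b - b'` is the same for `v₁`,
  -- `v₂`, `v₃`, hence `a₄ - b₄' = a₃ - b₄ + (b₁ - b₁')`. Injectivity of differences on `G` recovers
  -- the second point of `v₄`, and the remaining coordinates follow backwards along the chain.
  have hQ : Q.card ≤ (V ×ˢ A ×ˢ B).card := by
    refine Finset.card_le_card_of_injOn (fun q => (q.1, q.2.2.1.1.1, q.2.2.2.1.2)) ?_ ?_
    · intro q hq
      simp only [hQdef, Finset.coe_filter, Finset.mem_product, Set.mem_ofPred_eq] at hq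
      simp only [Finset.coe_product, Set.mem_prod, Finset.mem_coe]
      exact ⟨hq.1.1, hGA _ (hmem _ hq.1.2.2.1).1, hGB _ (hmem _ hq.1.2.2.2).1⟩
    · rintro ⟨v₁, v₂, v₃, v₄⟩ hv ⟨w₁, w₂, w₃, w₄⟩ hw h
      simp only [hQdef, Finset.coe_filter, Finset.mem_product, Set.mem_ofPred_eq,
        Prod.mk.injEq] at hv hw h
      obtain ⟨⟨hv₁, hv₂, hv₃, hv₄⟩, ⟨e1, e2⟩, ⟨e3, e4⟩, e5, e6⟩ := hv
      obtain ⟨⟨hw₁, hw₂, hw₃, hw₄⟩, ⟨k1, k2⟩, ⟨k3, k4⟩, k5, k6⟩ := hw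
      obtain ⟨rfl, h2, h3⟩ := h
      have a1 := (hmem _ hv₁).2.2
      have a2 := (hmem _ hv₂).2.2
      have a3 := (hmem _ hv₃).2.2
      have a4 := hmem _ hv₄
      have b2 := (hmem _ hw₂).2.2
      have b3 := (hmem _ hw₃).2.2
      have b4 := hmem _ hw₄
      have key : v₄.2 = w₄.2 := hinj _ a4.2.1 _ b4.2.1 (by linarith [a4.2.2, b4.2.2])
      have key1 := congrArg Prod.fst key
      have key2 := congrArg Prod.snd key
      have a42 := a4.2.2
      have b42 := b4.2.2
      simp only [Prod.mk.injEq, true_and]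
      refine ⟨Prod.ext (Prod.ext ?_ ?_) (Prod.ext ?_ ?_),
        Prod.ext (Prod.ext ?_ ?_) (Prod.ext ?_ ?_),
        Prod.ext (Prod.ext ?_ ?_) (Prod.ext ?_ ?_)⟩ <;> linarith
  simp only [Finset.card_product] at hch hQ
  have hN : V.card ^ 3 ≤ 64 * N ^ 8 := by
    rcases Nat.eq_zero_or_pos V.card with h0 | hpos
    · simp [h0]
    · refine Nat.le_of_mul_le_mul_left ?_ hpos
      calc V.card * V.card ^ 3 = V.card ^ 4 := by ring
        _ ≤ _ := hch
        _ ≤ 64 * (N * N * (N * N) * (N * N)) * (V.card * (N * N)) := by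
          refine Nat.mul_le_mul (by gcongr) (hQ.trans (by gcongr))
        _ = _ := by ring
  calc G.card ^ 6 = (G.card ^ 2) ^ 3 := by ring
    _ ≤ (N * V.card) ^ 3 := by
      gcongr
      exact hV.trans (by gcongr)
    _ = N ^ 3 * V.card ^ 3 := by ring
    _ ≤ N ^ 3 * (64 * N ^ 8) := by gcongr
    _ = _ := by ring

/-! ### Calculus of covering bounds. -/

/-- `E` can be covered, at each scale `δ ≤ 1`, by `O(δ⁻ᵗ)` balls of radius `O(δ)`. -/
def CovBound {X : Type*} [PseudoMetricSpace X] (E : Set X) (t : ℝ) : Prop :=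
  ∃ C K : ℝ, 0 < C ∧ 0 < K ∧ ∀ δ : ℝ, 0 < δ → δ ≤ 1 → ∃ Y : Finset X,
    (Y.card : ℝ) ≤ C * δ ^ (-t) ∧ ∀ x ∈ E, ∃ y ∈ Y, dist x y ≤ K * δ

namespace CovBound

variable {X Z : Type*} [PseudoMetricSpace X] [PseudoMetricSpace Z]

theorem mono {E F : Set X} {t : ℝ} (h : CovBound F t) (hEF : E ⊆ F) : CovBound E t := by
  obtain ⟨C, K, hC, hK, h⟩ := h
  refine ⟨C, K, hC, hK, fun δ h0 h1 => ?_⟩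
  obtain ⟨Y, hY, hY'⟩ := h δ h0 h1
  exact ⟨Y, hY, fun x hx => hY' x (hEF hx)⟩

theorem closure {E : Set X} {t : ℝ} (h : CovBound E t) : CovBound (closure E) t := by
  obtain ⟨C, K, hC, hK, h⟩ := h
  refine ⟨C, K, hC, hK, fun δ h0 h1 => ?_⟩
  obtain ⟨Y, hY, hY'⟩ := h δ h0 h1
  refine ⟨Y, hY, fun x hx => ?_⟩
  have hcl : IsClosed (⋃ y ∈ Y, Metric.closedBall y (K * δ)) :=
    isClosed_biUnion_finset fun _ _ => Metric.isClosed_closedBall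
  have hsub : E ⊆ ⋃ y ∈ Y, Metric.closedBall y (K * δ) := fun x hx => by
    simpa using hY' x hx
  simpa using closure_minimal hsub hcl hx

theorem union {E F : Set X} {t : ℝ} (hE : CovBound E t) (hF : CovBound F t) :
    CovBound (E ∪ F) t := by
  classical
  obtain ⟨C, K, hC, hK, hE⟩ := hE
  obtain ⟨C', K', hC', hK', hF⟩ := hF
  refine ⟨C + C', K + K', by positivity, by positivity, fun δ h0 h1 => ?_⟩
  obtain ⟨Y, hY, hEY⟩ := hE δ h0 h1
  obtain ⟨Y', hY', hFY⟩ := hF δ h0 h1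
  refine ⟨Y ∪ Y', ?_, ?_⟩
  · have : ((Y ∪ Y').card : ℝ) ≤ Y.card + Y'.card := by exact_mod_cast Finset.card_union_le _ _
    linarith
  · rintro x (hx | hx)
    · obtain ⟨y, hy, hd⟩ := hEY x hx
      exact ⟨y, Finset.mem_union_left _ hy, hd.trans (by nlinarith)⟩
    · obtain ⟨y, hy, hd⟩ := hFY x hx
      exact ⟨y, Finset.mem_union_right _ hy, hd.trans (by nlinarith)⟩

theorem image {E : Set X} {t L : ℝ} (hE : CovBound E t) (f : X → Z)
    (hf : ∀ x y, dist (f x) (f y) ≤ L * dist x y) : CovBound (f '' E) t := by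
  classical
  obtain ⟨C, K, hC, hK, hE⟩ := hE
  refine ⟨C, (|L| + 1) * K, hC, by positivity, fun δ h0 h1 => ?_⟩
  obtain ⟨Y, hY, hEY⟩ := hE δ h0 h1
  refine ⟨Y.image f, le_trans (by exact_mod_cast Finset.card_image_le) hY, ?_⟩
  rintro _ ⟨x, hx, rfl⟩
  obtain ⟨y, hy, hd⟩ := hEY x hx
  refine ⟨f y, Finset.mem_image_of_mem _ hy, (hf x y).trans ?_⟩
  calc L * dist x y ≤ (|L| + 1) * dist x y := by
        gcongr
        linarith [le_abs_self L]
    _ ≤ (|L| + 1) * (K * δ) := by gcongr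
    _ = _ := by ring

theorem prod {E : Set X} {F : Set Z} {t s : ℝ} (hE : CovBound E t) (hF : CovBound F s) :
    CovBound (E ×ˢ F) (t + s) := by
  obtain ⟨C, K, hC, hK, hE⟩ := hE
  obtain ⟨C', K', hC', hK', hF⟩ := hF
  refine ⟨C * C', K + K', by positivity, by positivity, fun δ h0 h1 => ?_⟩
  obtain ⟨Y, hY, hEY⟩ := hE δ h0 h1
  obtain ⟨Y', hY', hFY⟩ := hF δ h0 h1
  refine ⟨Y ×ˢ Y', ?_, ?_⟩
  · rw [Finset.card_product, Nat.cast_mul, neg_add, Real.rpow_add h0]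
    calc (Y.card : ℝ) * Y'.card ≤ (C * δ ^ (-t)) * (C' * δ ^ (-s)) := by gcongr
      _ = _ := by ring
  · rintro ⟨x, z⟩ ⟨hx, hz⟩
    obtain ⟨y, hy, hd⟩ := hEY x hx
    obtain ⟨y', hy', hd'⟩ := hFY z hz
    refine ⟨(y, y'), Finset.mem_product.2 ⟨hy, hy'⟩, ?_⟩
    rw [Prod.dist_eq]
    exact max_le (hd.trans (by nlinarith)) (hd'.trans (by nlinarith))

theorem mono_exponent {E : Set X} {t s : ℝ} (hE : CovBound E t) (hts : t ≤ s) :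
    CovBound E s := by
  obtain ⟨C, K, hC, hK, hE⟩ := hE
  refine ⟨C, K, hC, hK, fun δ h0 h1 => ?_⟩
  obtain ⟨Y, hY, hEY⟩ := hE δ h0 h1
  refine ⟨Y, hY.trans ?_, hEY⟩
  gcongr ?_ * ?_
  exact Real.rpow_le_rpow_of_exponent_ge h0 h1 (by linarith)

/-- A bounded interval is covered by `O(δ⁻¹)` intervals of length `O(δ)`. -/
theorem Icc (a b : ℝ) : CovBound (Set.Icc a b) 1 := by
  refine ⟨|b - a| + 1, 1, by positivity, one_pos, fun δ h0 h1 => ?_⟩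
  refine ⟨(Finset.range (⌊|b - a| / δ⌋₊ + 1)).image fun k : ℕ => a + k * δ, ?_, ?_⟩
  · refine le_trans (Nat.cast_le.2 Finset.card_image_le) ?_
    rw [Finset.card_range, Real.rpow_neg_one]
    push_cast
    have := Nat.floor_le (div_nonneg (abs_nonneg (b - a)) h0.le)
    have h2 : 1 ≤ δ⁻¹ := (one_le_inv₀ h0).2 h1
    rw [add_mul, ← div_eq_mul_inv]
    linarith
  · intro x hx
    have hxa : 0 ≤ (x - a) / δ := div_nonneg (by linarith [hx.1]) h0.le
    refine ⟨a + ⌊(x - a) / δ⌋₊ * δ, Finset.mem_image_of_mem _ (Finset.mem_range.2 ?_), ?_⟩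
    · refine Nat.lt_succ_of_le (Nat.floor_le_floor ?_)
      gcongr
      linarith [hx.2, le_abs_self (b - a)]
    · have e1 := Nat.floor_le hxa
      have e2 := Nat.lt_floor_add_one ((x - a) / δ)
      rw [le_div_iff₀ h0] at e1
      rw [div_lt_iff₀ h0] at e2
      rw [Real.dist_eq, abs_le]
      constructor <;> linarith

/-- Points at distance `O(δ)` lie in grid cells with nearby indices. -/
theorem floor_div_sub_floor_div_mem_Icc {K δ x y : ℝ} (h0 : 0 < δ) (hd : dist x y ≤ K * δ) :
    ⌊x / δ⌋ - ⌊y / δ⌋ ∈ Finset.Icc (-(⌈K⌉ + 1)) (⌈K⌉ + 1) := by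
  rw [Real.dist_eq, abs_le] at hd
  have e1 : x / δ ≤ y / δ + K := by
    rw [div_le_iff₀ h0, add_mul, div_mul_cancel₀ _ h0.ne']; linarith
  have e2 : y / δ ≤ x / δ + K := by
    rw [div_le_iff₀ h0, add_mul, div_mul_cancel₀ _ h0.ne']; linarith
  have l1 := Int.floor_le (x / δ)
  have l2 := Int.lt_floor_add_one (x / δ)
  have l3 := Int.floor_le (y / δ)
  have l4 := Int.lt_floor_add_one (y / δ)
  have l5 := Int.le_ceil K
  refine Finset.mem_Icc.2 ⟨?_, ?_⟩
  · have : ((⌊y / δ⌋ : ℤ) : ℝ) < ((⌊x / δ⌋ + (⌈K⌉ + 1) : ℤ) : ℝ) := by push_cast; linarith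
    have := Int.cast_lt.1 this
    omega
  · have : ((⌊x / δ⌋ : ℤ) : ℝ) < ((⌊y / δ⌋ + (⌈K⌉ + 1) : ℤ) : ℝ) := by push_cast; linarith
    have := Int.cast_lt.1 this
    omega

/-- The grid cells met by a set of real numbers. -/
theorem exists_grid {E : Set ℝ} {t : ℝ} (hE : CovBound E t) :
    ∃ C : ℝ, 0 < C ∧ ∀ δ : ℝ, 0 < δ → δ ≤ 1 → ∃ P : Finset ℤ,
      (P.card : ℝ) ≤ C * δ ^ (-t) ∧ ∀ x ∈ E, ⌊x / δ⌋ ∈ P := by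
  obtain ⟨C, K, hC, hK, hE⟩ := hE
  set J := Finset.Icc (-(⌈K⌉ + 1)) (⌈K⌉ + 1)
  refine ⟨C * (J.card + 1), by positivity, fun δ h0 h1 => ?_⟩
  obtain ⟨Y, hY, hEY⟩ := hE δ h0 h1
  refine ⟨(Y ×ˢ J).image fun z => ⌊z.1 / δ⌋ + z.2, ?_, ?_⟩
  · refine le_trans (Nat.cast_le.2 Finset.card_image_le) ?_
    rw [Finset.card_product, Nat.cast_mul]
    calc (Y.card : ℝ) * J.card ≤ C * δ ^ (-t) * (J.card + 1) := by gcongr; linarith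
      _ = _ := by ring
  · intro x hx
    obtain ⟨y, hy, hd⟩ := hEY x hx
    exact Finset.mem_image.2 ⟨(y, ⌊x / δ⌋ - ⌊y / δ⌋),
      Finset.mem_product.2 ⟨hy, floor_div_sub_floor_div_mem_Icc h0 hd⟩, by simp⟩

/-- The grid cells met by a planar set. -/
theorem exists_grid_prod {E : Set (ℝ × ℝ)} {t : ℝ} (hE : CovBound E t) :
    ∃ C : ℝ, 0 < C ∧ ∀ δ : ℝ, 0 < δ → δ ≤ 1 → ∃ P : Finset (ℤ × ℤ),
      (P.card : ℝ) ≤ C * δ ^ (-t) ∧ ∀ x ∈ E, (⌊x.1 / δ⌋, ⌊x.2 / δ⌋) ∈ P := by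
  obtain ⟨C, K, hC, hK, hE⟩ := hE
  set J := Finset.Icc (-(⌈K⌉ + 1)) (⌈K⌉ + 1)
  refine ⟨C * ((J.card + 1) * (J.card + 1)), by positivity, fun δ h0 h1 => ?_⟩
  obtain ⟨Y, hY, hEY⟩ := hE δ h0 h1
  refine ⟨(Y ×ˢ (J ×ˢ J)).image fun z => (⌊z.1.1 / δ⌋ + z.2.1, ⌊z.1.2 / δ⌋ + z.2.2), ?_, ?_⟩
  · refine le_trans (Nat.cast_le.2 Finset.card_image_le) ?_
    rw [Finset.card_product, Finset.card_product, Nat.cast_mul, Nat.cast_mul]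
    calc (Y.card : ℝ) * (J.card * J.card)
        ≤ C * δ ^ (-t) * ((J.card + 1) * (J.card + 1)) := by gcongr <;> linarith
      _ = _ := by ring
  · intro x hx
    obtain ⟨y, hy, hd⟩ := hEY x hx
    rw [Prod.dist_eq, max_le_iff] at hd
    exact Finset.mem_image.2 ⟨(y, ⌊x.1 / δ⌋ - ⌊y.1 / δ⌋, ⌊x.2 / δ⌋ - ⌊y.2 / δ⌋),
      Finset.mem_product.2 ⟨hy, Finset.mem_product.2
        ⟨floor_div_sub_floor_div_mem_Icc h0 hd.1, floor_div_sub_floor_div_mem_Icc h0 hd.2⟩⟩,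
      by simp⟩

/-- The abscissae of the vertical segments over `[p, q]` contained in a planar set satisfy a
covering bound with exponent smaller by one. -/
theorem slice {E : Set (ℝ × ℝ)} {s p q : ℝ} (hE : CovBound E s) (hpq : p < q) :
    CovBound {u : ℝ | ∀ y ∈ Set.Icc p q, (u, y) ∈ E} (s - 1) := by
  obtain ⟨C, hC, h⟩ := hE.exists_grid_prod
  have hqp : 0 < q - p := sub_pos.2 hpq
  refine ⟨C / (q - p), 1, by positivity, one_pos, fun δ h0 h1 => ?_⟩
  obtain ⟨P, hP, hEP⟩ := h δ h0 h1
  set J := Finset.Icc ⌊p / δ⌋ ⌊q / δ⌋ with hJ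
  set S := (P.image Prod.fst).filter fun k => ∀ j ∈ J, (k, j) ∈ P with hS
  have hle : ⌊p / δ⌋ ≤ ⌊q / δ⌋ := Int.floor_le_floor (by gcongr)
  have hsub : S ×ˢ J ⊆ P := by
    rintro ⟨k, j⟩ hkj
    rw [Finset.mem_product] at hkj
    exact (Finset.mem_filter.1 hkj.1).2 j hkj.2
  have hJcard : (q - p) / δ ≤ J.card := by
    have e : ((J.card : ℤ) : ℝ) = ⌊q / δ⌋ + 1 - ⌊p / δ⌋ := by
      rw [hJ, Int.card_Icc_of_le _ _ (by omega)]
      push_cast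
      ring
    have l2 := Int.lt_floor_add_one (q / δ)
    have l3 := Int.floor_le (p / δ)
    rw [Int.cast_natCast] at e
    rw [e, sub_div]
    linarith
  have hcard : (S.card : ℝ) * J.card ≤ C * δ ^ (-s) := by
    refine le_trans ?_ hP
    rw [← Nat.cast_mul, ← Finset.card_product]
    exact_mod_cast Finset.card_le_card hsub
  refine ⟨S.image fun k : ℤ => (k : ℝ) * δ, ?_, ?_⟩
  · refine le_trans (Nat.cast_le.2 Finset.card_image_le) ?_
    have h3 : (S.card : ℝ) * ((q - p) / δ) ≤ C * δ ^ (-s) :=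
      le_trans (by gcongr) hcard
    have h4 : δ ^ (-(s - 1)) = δ ^ (-s) * δ := by
      rw [show -(s - 1) = -s + 1 by ring, Real.rpow_add_one h0.ne']
    rw [h4, div_mul_eq_mul_div, le_div_iff₀ hqp, ← mul_assoc]
    rw [← mul_div_assoc, div_le_iff₀ h0] at h3
    exact h3
  · intro u hu
    have hmem : ∀ j ∈ J, (⌊u / δ⌋, j) ∈ P := by
      intro j hj
      rw [hJ, Finset.mem_Icc] at hj
      have l1 : (j : ℝ) * δ ≤ q := by
        rw [← le_div_iff₀ h0]
        exact le_trans (by exact_mod_cast hj.2) (Int.floor_le (q / δ))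
      rcases hj.1.eq_or_lt with rfl | hlt
      -- The lowest cell may have its corner `j * δ` below `p`, so the point `p` itself represents
      -- it.
      · exact hEP (u, p) (hu p ⟨le_rfl, hpq.le⟩)
      · have l2 : p ≤ (j : ℝ) * δ := by
          rw [← div_le_iff₀ h0]
          have : ((⌊p / δ⌋ + 1 : ℤ) : ℝ) ≤ j := by exact_mod_cast hlt
          push_cast at this
          linarith [Int.lt_floor_add_one (p / δ)]
        have := hEP (u, j * δ) (hu _ ⟨l2, l1⟩)
        simpa [h0.ne'] using this
    refine ⟨⌊u / δ⌋ * δ, Finset.mem_image_of_mem _ (Finset.mem_filter.2 ⟨?_, hmem⟩), ?_⟩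
    · exact Finset.mem_image.2 ⟨_, hmem ⌊p / δ⌋ (Finset.mem_Icc.2 ⟨le_rfl, hle⟩), rfl⟩
    · have e1 := Int.floor_le (u / δ)
      have e2 := Int.lt_floor_add_one (u / δ)
      rw [le_div_iff₀ h0] at e1
      rw [div_lt_iff₀ h0] at e2
      rw [Real.dist_eq, abs_le]
      constructor <;> linarith

end CovBound

/-! ### Covering bounds versus Minkowski and packing dimension. -/

theorem boxCoveringNumber_le {n : ℕ} {E : Set (Fin n → ℝ)} {ε : ℝ} {k : ℕ} (hk : 0 < k)
    (l u : Fin k → Fin n → ℝ) (hlu : ∀ j i, u j i - l j i ≤ ε) (hE : E ⊆ ⋃ j, Icc (l j) (u j)) :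
    boxCoveringNumber E ε ≤ k :=
  iInf₂_le k ⟨hk, l, u, hlu, hE⟩

theorem exists_cover_of_boxCoveringNumber_lt_top {n : ℕ} {E : Set (Fin n → ℝ)} {ε : ℝ}
    (hε : 0 ≤ ε) (h : boxCoveringNumber E ε < ⊤) :
    ∃ Y : Finset (Fin n → ℝ), (Y.card : ℕ∞) ≤ boxCoveringNumber E ε ∧
      ∀ x ∈ E, ∃ y ∈ Y, dist x y ≤ ε := by
  classical
  set S : Set ℕ := {k | 0 < k ∧ ∃ l u : Fin k → Fin n → ℝ,
    (∀ j i, u j i - l j i ≤ ε) ∧ E ⊆ ⋃ j, Icc (l j) (u j)} with hS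
  have hS' : boxCoveringNumber E ε = ⨅ k ∈ S, (k : ℕ∞) := rfl
  have hne : S.Nonempty := by
    by_contra hcon
    rw [Set.not_nonempty_iff_eq_empty] at hcon
    rw [hS', hcon] at h
    simp at h
  obtain ⟨hpos, l, u, hlu, hE⟩ := Nat.sInf_mem hne
  refine ⟨Finset.univ.image l, ?_, fun x hx => ?_⟩
  · rw [hS']
    refine le_iInf₂ fun k hk => ?_
    refine Nat.cast_le.2 (le_trans Finset.card_image_le ?_)
    simpa using Nat.sInf_le hk
  · obtain ⟨j, hj⟩ := mem_iUnion.1 (hE hx)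
    refine ⟨l j, Finset.mem_image_of_mem _ (Finset.mem_univ _), ?_⟩
    have hnn : ∀ i, |x i - l j i| ≤ ε := fun i => by
      have h1 := hj.1 i
      have h2 := hj.2 i
      rw [abs_le]
      constructor <;> linarith [hlu j i]
    exact (dist_pi_le_iff hε).2 hnn

theorem log_ofReal_rpow_neg {ε : ℝ} (h0 : 0 < ε) (t : ℝ) :
    ENNReal.log (ENNReal.ofReal (ε ^ (-t))) = ((t * Real.log (1 / ε) : ℝ) : EReal) := by
  rw [ENNReal.log_ofReal_of_pos (Real.rpow_pos_of_pos h0 _), Real.log_rpow h0, one_div,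
    Real.log_inv]
  congr 1
  ring

theorem log_div_log_le_iff {N : ENNReal} {ε : ℝ} (h0 : 0 < ε) (h1 : ε < 1) (t : ℝ) :
    ENNReal.log N / ((Real.log (1 / ε) : ℝ) : EReal) ≤ (t : EReal) ↔
      N ≤ ENNReal.ofReal (ε ^ (-t)) := by
  have hlog : 0 < Real.log (1 / ε) := Real.log_pos (by rw [one_div]; exact (one_lt_inv₀ h0).2 h1)
  rw [EReal.div_le_iff_le_mul (by exact_mod_cast hlog) (EReal.coe_ne_top _), ← EReal.coe_mul,
    mul_comm, ← log_ofReal_rpow_neg h0]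
  exact ENNReal.log_le_log_iff

/-- The limsup controls only small scales; replacing `δ` by `ρ * δ` covers all `δ ≤ 1` at the cost
of constants. -/
theorem covBound_of_minkowskiDim_lt {n : ℕ} {E : Set (Fin n → ℝ)} {t : ℝ}
    (h : minkowskiDim E < (t : EReal)) : CovBound E t := by
  have hev := eventually_lt_of_limsup_lt h
  rw [eventually_nhdsWithin_iff, Metric.eventually_nhds_iff] at hev
  obtain ⟨r, hr, hev⟩ := hev
  set ρ := min (r / 2) (1 / 2) with hρdef
  have hρ : 0 < ρ := by positivity
  refine ⟨ρ ^ (-t), ρ, by positivity, hρ, fun δ h0 h1 => ?_⟩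
  have hpos : 0 < ρ * δ := by positivity
  have hle : ρ * δ ≤ ρ := mul_le_of_le_one_right hρ.le h1
  have hρr : ρ ≤ r / 2 := min_le_left _ _
  have hρ1 : ρ ≤ 1 / 2 := min_le_right _ _
  have h2 := hev (y := ρ * δ) (by rw [Real.dist_eq, sub_zero, abs_of_pos hpos]; linarith) hpos
  have h3 := (log_div_log_le_iff hpos (by linarith) t).1 h2.le
  have hfin : boxCoveringNumber E (ρ * δ) < ⊤ := by
    rw [← ENat.toENNReal_lt_top]
    exact h3.trans_lt ENNReal.ofReal_lt_top
  obtain ⟨Y, hY, hEY⟩ := exists_cover_of_boxCoveringNumber_lt_top hpos.le hfin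
  refine ⟨Y, ?_, hEY⟩
  have h4 : ((Y.card : ℕ∞) : ENNReal) ≤ ENNReal.ofReal ((ρ * δ) ^ (-t)) :=
    (ENat.toENNReal_le.2 hY).trans h3
  rw [ENat.toENNReal_coe, ← ENNReal.ofReal_natCast,
    ENNReal.ofReal_le_ofReal_iff (by positivity)] at h4
  rwa [← Real.mul_rpow hρ.le h0.le]

/-- For every `z > t` the constants are absorbed by `ε ^ (z - t) → 0`. -/
theorem minkowskiDim_le_of_covBound {n : ℕ} {E : Set (Fin n → ℝ)} {t : ℝ} (ht : 0 ≤ t)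
    (hE : CovBound E t) : minkowskiDim E ≤ (t : EReal) := by
  obtain ⟨C, K, hC, hK, hE⟩ := hE
  refine EReal.le_of_forall_lt_iff_le.1 fun z hz => ?_
  have hz : t < z := by exact_mod_cast hz
  refine limsup_le_of_le (h := ?_)
  have hlim : Tendsto (fun ε : ℝ => (C + 1) * (2 * K) ^ t * ε ^ (z - t)) (𝓝[>] 0) (𝓝 0) := by
    have : Tendsto (fun ε : ℝ => ε ^ (z - t)) (𝓝[>] 0) (𝓝 0) := by
      have := (Real.continuousAt_rpow_const 0 (z - t) (Or.inr (by linarith))).tendsto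
      rw [Real.zero_rpow (by linarith)] at this
      exact this.mono_left nhdsWithin_le_nhds
    simpa using this.const_mul ((C + 1) * (2 * K) ^ t)
  have h1 : ∀ᶠ ε : ℝ in 𝓝[>] 0, ε < min 1 (2 * K) :=
    nhdsWithin_le_nhds (Iio_mem_nhds (by positivity))
  filter_upwards [hlim.eventually_lt_const one_pos, h1, self_mem_nhdsWithin] with ε hε hε1 hε0
  have hε0 : 0 < ε := hε0
  rw [lt_min_iff] at hε1
  rw [log_div_log_le_iff hε0 hε1.1]
  have hδ0 : 0 < ε / (2 * K) := by positivity
  have hδ1 : ε / (2 * K) ≤ 1 := (div_le_one (by positivity)).2 hε1.2.le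
  obtain ⟨Y, hY, hEY⟩ := hE _ hδ0 hδ1
  set e := Y.equivFin
  -- The extra degenerate box `{0}` keeps the number of boxes positive when `Y` is empty.
  have hN : boxCoveringNumber E ε ≤ ((Y.card + 1 : ℕ) : ℕ∞) := by
    refine boxCoveringNumber_le (Nat.succ_pos _)
      (Fin.cons 0 fun j i => (e.symm j : Fin n → ℝ) i - ε / 2)
      (Fin.cons 0 fun j i => (e.symm j : Fin n → ℝ) i + ε / 2) ?_ ?_
    · intro j i
      refine Fin.cases ?_ (fun j => ?_) j
      · simpa using hε0.le
      · simp only [Fin.cons_succ]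
        linarith
    · intro x hx
      obtain ⟨y, hy, hd⟩ := hEY x hx
      have hd' : dist x y ≤ ε / 2 := by
        refine hd.trans (le_of_eq ?_)
        field_simp
      refine mem_iUnion.2 ⟨(e ⟨y, hy⟩).succ, ?_⟩
      simp only [Fin.cons_succ, Equiv.symm_apply_apply]
      constructor <;> intro i <;>
      · have := (dist_le_pi_dist x y i).trans hd'
        rw [Real.dist_eq, abs_le] at this
        simp only
        linarith
  refine (ENat.toENNReal_le.2 hN).trans ?_
  rw [ENat.toENNReal_coe, ← ENNReal.ofReal_natCast]
  refine ENNReal.ofReal_le_ofReal ?_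
  have hδt : 1 ≤ (ε / (2 * K)) ^ (-t) :=
    Real.one_le_rpow_of_pos_of_le_one_of_nonpos hδ0 hδ1 (by linarith)
  push_cast
  calc (Y.card : ℝ) + 1 ≤ C * (ε / (2 * K)) ^ (-t) + (ε / (2 * K)) ^ (-t) := add_le_add hY hδt
    _ = (C + 1) * (2 * K) ^ t * ε ^ (-t) := by
      rw [Real.div_rpow hε0.le (by positivity), Real.rpow_neg (by positivity : 0 ≤ 2 * K)]
      field_simp
    _ = (C + 1) * (2 * K) ^ t * ε ^ (z - t) * ε ^ (-z) := by
      rw [mul_assoc _ (ε ^ (z - t)), ← Real.rpow_add hε0]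
      congr 2
      ring
    _ ≤ 1 * ε ^ (-z) := by gcongr
    _ = ε ^ (-z) := one_mul _

theorem packingDim_le_minkowskiDim {n : ℕ} (E : Set (Fin n → ℝ)) :
    packingDim E ≤ minkowskiDim E := by
  refine (iInf₂_le (fun _ => E) (subset_iUnion (fun _ : ℕ => E) 0)).trans ?_
  simp

theorem minPackingDim_le_minMinkowskiDim (S : Set (Fin 2 → ℝ)) :
    minPackingDim S ≤ minMinkowskiDim S :=
  iInf₂_mono fun B _ => packingDim_le_minkowskiDim B

/-- Covering bounds survive closure, so the pieces can be taken closed, as Baire's theorem requires.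
-/
theorem exists_covBound_of_packingDim_lt {n : ℕ} {B : Set (Fin n → ℝ)} {s : ℝ}
    (h : packingDim B < (s : EReal)) :
    ∃ F : ℕ → Set (Fin n → ℝ), B ⊆ ⋃ j, F j ∧ ∀ j, IsClosed (F j) ∧ CovBound (F j) s := by
  simp only [packingDim, iInf_lt_iff] at h
  obtain ⟨F, hF, hs⟩ := h
  refine ⟨fun j => closure (F j), hF.trans (iUnion_mono fun j => subset_closure), fun j => ?_⟩
  exact ⟨isClosed_closure, (covBound_of_minkowskiDim_lt ((le_iSup _ j).trans_lt hs)).closure⟩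

/-! ### From a planar set to the coordinates of sides. -/

/-- The Baire category theorem on an interval. -/
theorem exists_rat_Icc_subset_of_closed_cover {ι : Type*} [Countable ι] {f : ι → Set ℝ}
    (hc : ∀ i, IsClosed (f i)) {a b : ℝ} (hab : a < b) (hcov : Icc a b ⊆ ⋃ i, f i) :
    ∃ i, ∃ p q : ℚ, p < q ∧ Icc (p : ℝ) q ⊆ f i := by
  -- Adding the complement of the open interval turns the cover into a closed cover of the whole
  -- line.
  set g : Option ι → Set ℝ := fun o => o.elim (Ioo a b)ᶜ f with hg
  have hgc : ∀ o, IsClosed (g o) := by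
    rintro (_ | i)
    · exact isOpen_Ioo.isClosed_compl
    · exact hc i
  have hgu : ⋃ o, g o = univ := by
    refine eq_univ_of_forall fun x => mem_iUnion.2 ?_
    by_cases hx : x ∈ Ioo a b
    · obtain ⟨i, hi⟩ := mem_iUnion.1 (hcov (Ioo_subset_Icc_self hx))
      exact ⟨some i, hi⟩
    · exact ⟨none, hx⟩
  obtain ⟨x, hx, hxu⟩ := (dense_iUnion_interior_of_closed hgc hgu).inter_open_nonempty
    (Ioo a b) isOpen_Ioo (nonempty_Ioo.2 hab)
  obtain ⟨o, ho⟩ := mem_iUnion.1 hxu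
  rcases o with _ | i
  · exact absurd hx (interior_subset ho)
  · obtain ⟨r, hr, hball⟩ := Metric.isOpen_iff.1 isOpen_interior x ho
    obtain ⟨p, hp1, hp2⟩ := exists_rat_btwn (show x - r < x by linarith)
    obtain ⟨q, hq1, hq2⟩ := exists_rat_btwn (show x < x + r by linarith)
    refine ⟨i, p, q, by exact_mod_cast hp2.trans hq1, fun y hy => interior_subset (hball ?_)⟩
    rw [Metric.mem_ball, Real.dist_eq, abs_lt]
    constructor <;> linarith [hy.1, hy.2]

theorem dist_vecCons_le (z w : ℝ × ℝ) : dist ![z.1, z.2] ![w.1, w.2] ≤ 1 * dist z w := by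
  rw [one_mul, dist_pi_le_iff dist_nonneg, Fin.forall_fin_two]
  exact ⟨le_max_left _ _, le_max_right _ _⟩

theorem continuous_vecCons_pair : Continuous fun z : ℝ × ℝ => ![z.1, z.2] :=
  continuous_pi fun i => by fin_cases i <;> simp <;> fun_prop

theorem segment_graph_eq_image {a b : ℝ} (hab : a ≤ b) (c : ℝ) :
    segment ℝ ![a, c * a] ![b, c * b] = (fun t => ![t, c * t]) '' Icc a b := by
  have h := (image_segment ℝ ((LinearMap.toSpanSingleton ℝ (Fin 2 → ℝ) ![1, c]).toAffineMap) a b)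
  rw [segment_eq_Icc hab] at h
  have e : ∀ t : ℝ, (LinearMap.toSpanSingleton ℝ (Fin 2 → ℝ) ![1, c]).toAffineMap t =
      ![t, c * t] := by
    intro t
    ext i
    fin_cases i <;> simp [mul_comm]
  simp only [e] at h
  rw [← h]

/-- The abscissae of the vertical segments over `[p, q]` contained in a thin planar set. -/
theorem covBound_vertical {E : Set (Fin 2 → ℝ)} {s p q : ℝ} (hE : CovBound E s) (hpq : p < q) :
    CovBound {u : ℝ | ∀ y ∈ Icc p q, ![u, y] ∈ E} (s - 1) := by
  have h := (hE.image (L := 1) (fun z : Fin 2 → ℝ => (z 0, z 1)) fun z w => by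
    rw [one_mul, Prod.dist_eq]
    exact max_le (dist_le_pi_dist z w 0) (dist_le_pi_dist z w 1)).slice hpq
  exact h.mono fun u hu y hy => ⟨![u, y], hu y hy, by simp⟩

/-- The ordinates of the horizontal segments over `[p, q]` contained in a thin planar set. -/
theorem covBound_horizontal {E : Set (Fin 2 → ℝ)} {s p q : ℝ} (hE : CovBound E s) (hpq : p < q) :
    CovBound {y : ℝ | ∀ u ∈ Icc p q, ![u, y] ∈ E} (s - 1) := by
  have h := (hE.image (L := 1) (fun z : Fin 2 → ℝ => (z 1, z 0)) fun z w => by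
    rw [one_mul, Prod.dist_eq]
    exact max_le (dist_le_pi_dist z w 1) (dist_le_pi_dist z w 0)).slice hpq
  exact h.mono fun u hu y hy => ⟨![y, u], hu y hy, by simp⟩

theorem isClosed_vertical {E : Set (Fin 2 → ℝ)} (hE : IsClosed E) (I : Set ℝ) :
    IsClosed {u : ℝ | ∀ y ∈ I, ![u, y] ∈ E} := by
  have : {u : ℝ | ∀ y ∈ I, ![u, y] ∈ E} = ⋂ y ∈ I, {u : ℝ | ![u, y] ∈ E} := by ext; simp
  rw [this]
  exact isClosed_biInter fun y _ => hE.preimage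
    (continuous_vecCons_pair.comp (by fun_prop : Continuous fun u : ℝ => (u, y)))

theorem isClosed_horizontal {E : Set (Fin 2 → ℝ)} (hE : IsClosed E) (I : Set ℝ) :
    IsClosed {y : ℝ | ∀ u ∈ I, ![u, y] ∈ E} := by
  have : {y : ℝ | ∀ u ∈ I, ![u, y] ∈ E} = ⋂ u ∈ I, {y : ℝ | ![u, y] ∈ E} := by ext; simp
  rw [this]
  exact isClosed_biInter fun u _ => hE.preimage
    (continuous_vecCons_pair.comp (by fun_prop : Continuous fun y : ℝ => (u, y)))

/-- A set of packing dimension less than `s` which contains squares centred at the points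
`(x, c x)` yields, for the `x` in a subinterval, sets of coordinates of the right, left and upper
sides with dimension at most `s - 1`. -/
theorem exists_side_sets_of_packingDim_lt {a b c s : ℝ} (hab : a < b) {B : Set (Fin 2 → ℝ)}
    (hB : ContainsSquares (segment ℝ ![a, c * a] ![b, c * b]) B)
    (hs : packingDim B < (s : EReal)) :
    ∃ U V W : Set ℝ, CovBound U (s - 1) ∧ CovBound V (s - 1) ∧ CovBound W (s - 1) ∧
      ∃ p q R : ℝ, p < q ∧ ∀ x ∈ Icc p q, ∃ r, 0 < r ∧ r ≤ R ∧
        x + r ∈ U ∧ x - r ∈ V ∧ c * x + r ∈ W := by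
  obtain ⟨F, hBF, hF⟩ := exists_covBound_of_packingDim_lt hs
  -- An index records a piece `F j` and a rational interval; there are countably many.
  set T := {k : ℕ × ℚ × ℚ // k.2.1 < k.2.2}
  set vert : T → Set ℝ := fun k =>
    {u | ∀ y ∈ Icc (k.1.2.1 : ℝ) k.1.2.2, ![u, y] ∈ F k.1.1} with hvert
  set horiz : T → Set ℝ := fun k =>
    {y | ∀ u ∈ Icc (k.1.2.1 : ℝ) k.1.2.2, ![u, y] ∈ F k.1.1} with hhoriz
  have hvc : ∀ k, IsClosed (vert k) := fun k => isClosed_vertical (hF _).1 _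
  have hhc : ∀ k, IsClosed (horiz k) := fun k => isClosed_horizontal (hF _).1 _
  have hvb : ∀ k, CovBound (vert k) (s - 1) := fun k =>
    covBound_vertical (hF _).2 (by exact_mod_cast k.2)
  have hhb : ∀ k, CovBound (horiz k) (s - 1) := fun k =>
    covBound_horizontal (hF _).2 (by exact_mod_cast k.2)
  have hside : ∀ u α β : ℝ, α < β → (∀ y ∈ Icc α β, ![u, y] ∈ B) → ∃ k, u ∈ vert k := by
    intro u α β hαβ h
    obtain ⟨j, p, q, hpq, hsub⟩ := exists_rat_Icc_subset_of_closed_cover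
      (f := fun j => {y : ℝ | ![u, y] ∈ F j})
      (fun j => (hF j).1.preimage
        (continuous_vecCons_pair.comp (by fun_prop : Continuous fun y : ℝ => (u, y)))) hαβ
      (fun y hy => by simpa using hBF (h y hy))
    exact ⟨⟨(j, p, q), hpq⟩, fun y hy => hsub hy⟩
  have htop : ∀ y α β : ℝ, α < β → (∀ u ∈ Icc α β, ![u, y] ∈ B) → ∃ k, y ∈ horiz k := by
    intro y α β hαβ h
    obtain ⟨j, p, q, hpq, hsub⟩ := exists_rat_Icc_subset_of_closed_cover
      (f := fun j => {u : ℝ | ![u, y] ∈ F j})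
      (fun j => (hF j).1.preimage
        (continuous_vecCons_pair.comp (by fun_prop : Continuous fun u : ℝ => (u, y)))) hαβ
      (fun u hu => by simpa using hBF (h u hu))
    exact ⟨⟨(j, p, q), hpq⟩, fun u hu => hsub hu⟩
  -- Confining `r` to `[1 / (m + 1), m]` makes `Z k` compact, so its projection to `x` is closed; it
  -- also keeps `r` positive and bounded on the final interval.
  set Z : T × T × T × ℕ → Set (ℝ × ℝ) := fun k =>
    (Icc a b ×ˢ Icc (1 / ((k.2.2.2 : ℝ) + 1)) k.2.2.2) ∩ ((fun z => z.1 + z.2) ⁻¹' vert k.1 ∩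
      ((fun z => z.1 - z.2) ⁻¹' vert k.2.1 ∩ (fun z => c * z.1 + z.2) ⁻¹' horiz k.2.2.1)) with hZ
  have hZc : ∀ k, IsCompact (Z k) := fun k =>
    (isCompact_Icc.prod isCompact_Icc).inter_right
      (((hvc _).preimage (by fun_prop)).inter
        (((hvc _).preimage (by fun_prop)).inter ((hhc _).preimage (by fun_prop))))
  have hcov : Icc a b ⊆ ⋃ k, Prod.fst '' Z k := by
    intro x hx
    obtain ⟨r, hr, hsq⟩ := hB ![x, c * x]
      (by rw [segment_graph_eq_image hab.le]; exact ⟨x, hx, rfl⟩)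
    have hpt : ∀ ξ η : ℝ, max |ξ| |η| = r → ![x + ξ, c * x + η] ∈ B := by
      intro ξ η h
      have := hsq ![ξ / r, η / r] (by
        simp only [unitSquare, Set.mem_ofPred_eq, Matrix.cons_val_zero, Matrix.cons_val_one]
        rw [abs_div, abs_div, abs_of_pos hr, max_div_div_right hr.le, h, div_self hr.ne'])
      convert this using 1
      ext i
      fin_cases i <;> simp <;> field_simp
    obtain ⟨k₁, hk₁⟩ := hside (x + r) (c * x - r) (c * x + r) (by linarith) (fun y hy => by
      have := hpt r (y - c * x) (by
        rw [abs_of_pos hr]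
        exact max_eq_left (abs_le.2 ⟨by linarith [hy.1], by linarith [hy.2]⟩))
      rwa [add_sub_cancel] at this)
    obtain ⟨k₂, hk₂⟩ := hside (x - r) (c * x - r) (c * x + r) (by linarith) (fun y hy => by
      have := hpt (-r) (y - c * x) (by
        rw [abs_neg, abs_of_pos hr]
        exact max_eq_left (abs_le.2 ⟨by linarith [hy.1], by linarith [hy.2]⟩))
      rwa [add_sub_cancel, ← sub_eq_add_neg] at this)
    obtain ⟨k₃, hk₃⟩ := htop (c * x + r) (x - r) (x + r) (by linarith) (fun u hu => by
      have := hpt (u - x) r (by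
        rw [abs_of_pos hr]
        exact max_eq_right (abs_le.2 ⟨by linarith [hu.1], by linarith [hu.2]⟩))
      rwa [add_sub_cancel] at this)
    obtain ⟨m, hm⟩ := exists_nat_ge (max r (1 / r))
    have hm1 := (le_max_left _ _).trans hm
    have hm2 := (le_max_right _ _).trans hm
    refine mem_iUnion.2 ⟨(k₁, k₂, k₃, m), (x, r), ⟨⟨hx, ?_, hm1⟩, hk₁, hk₂, hk₃⟩, rfl⟩
    simp only
    rw [div_le_iff₀ (by positivity)]
    rw [div_le_iff₀ hr] at hm2
    nlinarith
  obtain ⟨k, p, q, hpq, hsub⟩ := exists_rat_Icc_subset_of_closed_cover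
    (fun k => ((hZc k).image continuous_fst).isClosed) hab hcov
  refine ⟨vert k.1, vert k.2.1, horiz k.2.2.1, hvb _, hvb _, hhb _, p, q, k.2.2.2,
    by exact_mod_cast hpq, fun x hx => ?_⟩
  obtain ⟨⟨x', r⟩, ⟨⟨_, hr1, hr2⟩, h1, h2, h3⟩, rfl⟩ := hsub hx
  exact ⟨r, lt_of_lt_of_le (by positivity) hr1, hr2, h1, h2, h3⟩

/-! ### From coordinates of sides to a planar set. -/

/-- Sets containing the coordinates of the sides of squares centred at the points `(x, c x)`
yield a planar set containing these squares, with dimension larger by one. -/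
theorem minMinkowskiDim_segment_le {a b c t R : ℝ} (hab : a ≤ b) (ht : 0 ≤ t) {X Y : Set ℝ}
    (hX : CovBound X t) (hY : CovBound Y t)
    (h : ∀ x ∈ Icc a b, ∃ r, 0 < r ∧ r ≤ R ∧ x + r ∈ X ∧ x - r ∈ X ∧
      c * x + r ∈ Y ∧ c * x - r ∈ Y) :
    minMinkowskiDim (segment ℝ ![a, c * a] ![b, c * b]) ≤ ((t + 1 : ℝ) : EReal) := by
  set m := max |a| |b|
  -- `(1 + |c|) * m` bounds both coordinates of every centre, so `I` contains all coordinates of all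
  -- the squares.
  set M := (1 + |c|) * m + R
  set I := Icc (-M) M
  have hm : ∀ x ∈ Icc a b, |x| ≤ m := fun x hx => abs_le_max_abs_abs hx.1 hx.2
  have hcov : CovBound ((fun z : ℝ × ℝ => ![z.1, z.2]) '' (X ×ˢ I ∪ I ×ˢ Y)) (t + 1) :=
    ((hX.prod (CovBound.Icc _ _)).union
      (by simpa [add_comm] using (CovBound.Icc (-M) M).prod hY)).image _ dist_vecCons_le
  refine (iInf₂_le _ ?_).trans (minkowskiDim_le_of_covBound (by linarith) hcov)
  rw [segment_graph_eq_image hab]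
  rintro _ ⟨x, hx, rfl⟩
  obtain ⟨r, hr, hrR, h1, h2, h3, h4⟩ := h x hx
  refine ⟨r, hr, fun p hp => ⟨(x + r * p 0, c * x + r * p 1), ?_, ?_⟩⟩
  · have hp : max |p 0| |p 1| = 1 := hp
    have hp0 : |p 0| ≤ 1 := hp ▸ le_max_left _ _
    have hp1 : |p 1| ≤ 1 := hp ▸ le_max_right _ _
    have hb : ∀ y p : ℝ, |y| ≤ (1 + |c|) * m → |p| ≤ 1 → y + r * p ∈ I := by
      intro y p hy hp
      refine abs_le.1 ((abs_add_le _ _).trans (add_le_add hy ?_))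
      rw [abs_mul, abs_of_pos hr]
      exact (mul_le_of_le_one_right hr.le hp).trans hrR
    have hxm := hm x hx
    have hc0 := abs_nonneg c
    have hx0 := abs_nonneg x
    have hxI : x + r * p 0 ∈ I := hb _ _ (by nlinarith) hp0
    have hyI : c * x + r * p 1 ∈ I := hb _ _ (by rw [abs_mul]; nlinarith) hp1
    rcases max_choice |p 0| |p 1| with hmax | hmax <;> rw [hmax] at hp
    · refine Or.inl ⟨?_, hyI⟩
      rcases eq_or_eq_neg_of_abs_eq hp with e | e <;> simp only [e]
      · simpa using h1
      · simpa [← sub_eq_add_neg] using h2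
    · refine Or.inr ⟨hxI, ?_⟩
      rcases eq_or_eq_neg_of_abs_eq hp with e | e <;> simp only [e]
      · simpa using h3
      · simpa [← sub_eq_add_neg] using h4
  · ext i
    fin_cases i <;> simp

/-- Rescaled version of `minMinkowskiDim_segment_le`. -/
theorem minMinkowskiDim_segment_le_of_rescale {a b c t p q R : ℝ} (hab : a < b) (hpq : p < q)
    (ht : 0 ≤ t) {X Y : Set ℝ} (hX : CovBound X t) (hY : CovBound Y t)
    (h : ∀ x ∈ Icc p q, ∃ r, 0 < r ∧ r ≤ R ∧ x + r ∈ X ∧ x - r ∈ X ∧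
      c * x + r ∈ Y ∧ c * x - r ∈ Y) :
    minMinkowskiDim (segment ℝ ![a, c * a] ![b, c * b]) ≤ ((t + 1 : ℝ) : EReal) := by
  set l := (b - a) / (q - p) with hl
  have hqp : 0 < q - p := sub_pos.2 hpq
  have hl0 : 0 < l := div_pos (sub_pos.2 hab) hqp
  have haff : ∀ m x y : ℝ, dist (l * x + m) (l * y + m) ≤ l * dist x y := fun m x y => by
    rw [dist_add_right, Real.dist_eq, Real.dist_eq, ← mul_sub, abs_mul, abs_of_pos hl0]
  refine minMinkowskiDim_segment_le (R := l * R) hab.le ht (hX.image _ (haff (a - l * p)))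
    (hY.image _ (haff (c * (a - l * p)))) fun x hx => ?_
  have hlq : l * (q - p) = b - a := div_mul_cancel₀ _ hqp.ne'
  obtain ⟨r, hr, hrR, h1, h2, h3, h4⟩ := h (p + (x - a) / l)
    ⟨by have := div_nonneg (sub_nonneg.2 hx.1) hl0.le; linarith, by
      have : (x - a) / l ≤ q - p := by rw [div_le_iff₀ hl0]; nlinarith [hx.2]
      linarith⟩
  refine ⟨l * r, by positivity, by gcongr, ⟨_, h1, ?_⟩, ⟨_, h2, ?_⟩, ⟨_, h3, ?_⟩, ⟨_, h4, ?_⟩⟩ <;>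
  · field_simp
    ring

/-! ### Discretization and lower bounds for the coordinate sets. -/

theorem exists_discretization {p q δ : ℝ} (hpq : p < q) (h0 : 0 < δ) {Φ : ℝ → ℝ → Prop}
    (h : ∀ x ∈ Icc p q, ∃ r, Φ x r) :
    ∃ G : Finset (ℤ × ℤ), (q - p) / δ ≤ G.card ∧
      (∀ g ∈ G, ∃ x r, Φ x r ∧ g = (⌊(x + r) / δ⌋, ⌊-(x - r) / δ⌋)) ∧
      ∀ g ∈ G, ∀ g' ∈ G, g.1 - g.2 = g'.1 - g'.2 → g = g' := by
  choose! ρ hρ using h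
  set g : ℕ → ℤ × ℤ := fun i =>
    (⌊((p + i * δ) + ρ (p + i * δ)) / δ⌋, ⌊-((p + i * δ) - ρ (p + i * δ)) / δ⌋) with hg
  -- The difference of the two floors is within 1 of twice the sample point over `δ`. These values
  -- are spaced by 2, so the difference determines `i`.
  have hnear : ∀ i : ℕ, |(((g i).1 - (g i).2 : ℤ) : ℝ) - (2 * p / δ + 2 * i)| < 1 := by
    intro i
    have l1 := Int.floor_le (((p + i * δ) + ρ (p + i * δ)) / δ)
    have l2 := Int.lt_floor_add_one (((p + i * δ) + ρ (p + i * δ)) / δ)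
    have l3 := Int.floor_le (-((p + i * δ) - ρ (p + i * δ)) / δ)
    have l4 := Int.lt_floor_add_one (-((p + i * δ) - ρ (p + i * δ)) / δ)
    have e : 2 * p / δ + 2 * i = ((p + i * δ) + ρ (p + i * δ)) / δ -
        -((p + i * δ) - ρ (p + i * δ)) / δ := by
      field_simp
      ring
    rw [e, abs_lt]
    simp only [hg]
    push_cast
    constructor <;> linarith
  have hinj : ∀ i j : ℕ, (g i).1 - (g i).2 = (g j).1 - (g j).2 → i = j := by
    intro i j hij
    have hi := abs_lt.1 (hnear i)
    have hj := abs_lt.1 (hnear j)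
    rw [hij] at hi
    have h1 : (i : ℝ) < j + 1 := by linarith [hi.1, hj.2]
    have h2 : (j : ℝ) < i + 1 := by linarith [hi.2, hj.1]
    have h1' : i < j + 1 := by exact_mod_cast h1
    have h2' : j < i + 1 := by exact_mod_cast h2
    omega
  refine ⟨(Finset.range (⌊(q - p) / δ⌋₊ + 1)).image g, ?_, ?_, ?_⟩
  · rw [Finset.card_image_of_injective _ fun i j hij => hinj i j (by rw [hij]),
      Finset.card_range]
    push_cast
    exact (Nat.lt_floor_add_one _).le
  · intro γ hγ
    obtain ⟨i, hi, rfl⟩ := Finset.mem_image.1 hγ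
    refine ⟨p + i * δ, ρ (p + i * δ), hρ _ ⟨by nlinarith [Nat.cast_nonneg (α := ℝ) i], ?_⟩, rfl⟩
    have hi' : (i : ℝ) ≤ (q - p) / δ :=
      (Nat.le_floor_iff (by have := sub_pos.2 hpq; positivity)).1
        (Nat.lt_succ_iff.1 (Finset.mem_range.1 hi))
    rw [le_div_iff₀ h0] at hi'
    linarith
  · intro γ hγ γ' hγ' e
    obtain ⟨i, _, rfl⟩ := Finset.mem_image.1 hγ
    obtain ⟨j, _, rfl⟩ := Finset.mem_image.1 hγ'
    rw [hinj i j e]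

theorem exponent_le_of_forall_rpow_le {κ C α β : ℝ} (hκ : 0 < κ)
    (h : ∀ δ : ℝ, 0 < δ → δ ≤ 1 → κ * δ ^ (-α) ≤ C * δ ^ (-β)) : α ≤ β := by
  by_contra! hlt
  have hlim : Tendsto (fun ε : ℝ => C * ε ^ (α - β)) (𝓝[>] 0) (𝓝 0) := by
    have := (Real.continuousAt_rpow_const 0 (α - β) (Or.inr (by linarith))).tendsto
    rw [Real.zero_rpow (by linarith)] at this
    simpa using (this.mono_left nhdsWithin_le_nhds).const_mul C
  have h1 : ∀ᶠ ε : ℝ in 𝓝[>] 0, ε < 1 := nhdsWithin_le_nhds (Iio_mem_nhds one_pos)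
  obtain ⟨δ, hδ, hδ1, hδ0⟩ :=
    ((hlim.eventually_lt_const hκ).and (h1.and self_mem_nhdsWithin)).exists
  have hδ0 : 0 < δ := hδ0
  have h2 := h δ hδ0 hδ1.le
  have h3 : δ ^ (α - β) * δ ^ (-α) = δ ^ (-β) := by
    rw [← Real.rpow_add hδ0]
    congr 1
    ring
  rw [← h3, ← mul_assoc] at h2
  exact absurd (le_of_mul_le_mul_right h2 (Real.rpow_pos_of_pos hδ0 _)) (not_le.2 hδ)

theorem CovBound.neg {V : Set ℝ} {t : ℝ} (hV : CovBound V t) :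
    CovBound ((fun x => -x) '' V) t :=
  hV.image (L := 1) _ fun x y => by rw [dist_neg_neg, one_mul]

theorem half_le_of_covBound {U V : Set ℝ} {t p q : ℝ} (hpq : p < q)
    (hU : CovBound U t) (hV : CovBound V t)
    (h : ∀ x ∈ Icc p q, ∃ r, x + r ∈ U ∧ x - r ∈ V) : 1 / 2 ≤ t := by
  obtain ⟨C₁, hC₁, hU⟩ := hU.exists_grid
  obtain ⟨C₂, hC₂, hV⟩ := hV.neg.exists_grid
  have key : (1 : ℝ) ≤ 2 * t := by
    refine exponent_le_of_forall_rpow_le (sub_pos.2 hpq) (C := C₁ * C₂) fun δ h0 h1 => ?_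
    obtain ⟨A, hA, hUA⟩ := hU δ h0 h1
    obtain ⟨B, hB, hVB⟩ := hV δ h0 h1
    obtain ⟨G, hG, hGm, -⟩ := exists_discretization hpq h0 h
    have hsub : G ⊆ A ×ˢ B := by
      intro g hg
      obtain ⟨x, r, ⟨hx1, hx2⟩, rfl⟩ := hGm g hg
      exact Finset.mem_product.2 ⟨hUA _ hx1, hVB _ ⟨_, hx2, rfl⟩⟩
    calc (q - p) * δ ^ (-1 : ℝ) = (q - p) / δ := by rw [Real.rpow_neg_one, div_eq_mul_inv]
      _ ≤ G.card := hG
      _ ≤ A.card * B.card := by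
        rw [← Nat.cast_mul, ← Finset.card_product]
        exact_mod_cast Finset.card_le_card hsub
      _ ≤ (C₁ * δ ^ (-t)) * (C₂ * δ ^ (-t)) := by gcongr
      _ = C₁ * C₂ * δ ^ (-(2 * t)) := by
        rw [show -(2 * t) = -t + -t by ring, Real.rpow_add h0]
        ring
  linarith

/-- Katz–Tao is applied to the cells of `x + r` and `-(x - r)`; their sums lie near cells of `2 *
r`, and about `δ⁻¹` differences are distinct. -/
theorem six_div_eleven_le_of_covBound {U V W : Set ℝ} {t p q : ℝ} (hpq : p < q)
    (hU : CovBound U t) (hV : CovBound V t) (hW : CovBound W t)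
    (h : ∀ x ∈ Icc p q, ∃ r, x + r ∈ U ∧ x - r ∈ V ∧ r ∈ W) : 6 / 11 ≤ t := by
  classical
  obtain ⟨C₁, hC₁, hU⟩ := hU.exists_grid
  obtain ⟨C₂, hC₂, hV⟩ := hV.neg.exists_grid
  obtain ⟨C₃, hC₃, hW⟩ := (hW.image (L := 2) (fun x => 2 * x) fun x y => by
    rw [Real.dist_eq, Real.dist_eq, ← mul_sub, abs_mul, abs_two]).exists_grid
  have key : (6 : ℝ) ≤ 11 * t := by
    refine exponent_le_of_forall_rpow_le (pow_pos (sub_pos.2 hpq) 6)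
      (C := 64 * (C₁ + C₂ + 2 * C₃) ^ 11) fun δ h0 h1 => ?_
    obtain ⟨A, hA, hUA⟩ := hU δ h0 h1
    obtain ⟨B, hB, hVB⟩ := hV δ h0 h1
    obtain ⟨P, hP, hWP⟩ := hW δ h0 h1
    obtain ⟨G, hG, hGm, hinj⟩ := exists_discretization hpq h0 h
    -- The floor of a sum exceeds the sum of the floors by 0 or 1, so `P` is enlarged by its shift.
    have hPcard : (P ∪ P.image (· - 1)).card ≤ P.card + P.card :=
      (Finset.card_union_le _ _).trans (Nat.add_le_add_left Finset.card_image_le _)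
    have hKT := katz_tao_sums_differences A B (P ∪ P.image (· - 1)) G
      (A.card + B.card + (P.card + P.card)) (by omega) (by omega) (by omega)
      (fun g hg => by
        obtain ⟨x, r, ⟨hx1, hx2, hx3⟩, rfl⟩ := hGm g hg
        exact hUA _ hx1)
      (fun g hg => by
        obtain ⟨x, r, ⟨hx1, hx2, hx3⟩, rfl⟩ := hGm g hg
        exact hVB _ ⟨_, hx2, rfl⟩)
      (fun g hg => by
        obtain ⟨x, r, ⟨hx1, hx2, hx3⟩, rfl⟩ := hGm g hg
        have hm := hWP _ ⟨r, hx3, rfl⟩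
        have e : 2 * r / δ = (x + r) / δ + -(x - r) / δ := by ring
        simp only [e] at hm
        rcases Int.le_floor_add ((x + r) / δ) (-(x - r) / δ) |>.eq_or_lt with h5 | h5
        · rw [← h5] at hm
          exact Finset.mem_union_left _ hm
        · have h6 := Int.le_floor_add_floor ((x + r) / δ) (-(x - r) / δ)
          refine Finset.mem_union_right _ (Finset.mem_image.2 ⟨_, hm, ?_⟩)
          simp only
          omega) hinj
    have hNr : ((A.card + B.card + (P.card + P.card) : ℕ) : ℝ) ≤
        (C₁ + C₂ + 2 * C₃) * δ ^ (-t) := by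
      push_cast
      linarith
    calc (q - p) ^ 6 * δ ^ (-6 : ℝ) = ((q - p) / δ) ^ 6 := by
          rw [div_pow, div_eq_mul_inv, Real.rpow_neg h0.le]
          norm_cast
      _ ≤ (G.card : ℝ) ^ 6 := by
        have := sub_pos.2 hpq
        gcongr
      _ ≤ 64 * ((A.card + B.card + (P.card + P.card) : ℕ) : ℝ) ^ 11 := by exact_mod_cast hKT
      _ ≤ 64 * ((C₁ + C₂ + 2 * C₃) * δ ^ (-t)) ^ 11 := by gcongr
      _ = 64 * (C₁ + C₂ + 2 * C₃) ^ 11 * δ ^ (-(11 * t)) := by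
        rw [mul_pow, ← Real.rpow_mul_natCast h0.le, ← mul_assoc]
        congr 2
        push_cast
        ring
  linarith

/-! ### Digit sets and the explicit constructions. -/

/-- The numbers in `[0, 1]` with a binary expansion supported on the places `≡ i (mod p)`. -/
def digitSet (p i : ℕ) : Set ℝ :=
  {x | ∃ d : ℕ → Fin 2, (∀ k, k % p ≠ i → d k = 0) ∧ Real.ofDigits d = x}

theorem digitSet_subset_Icc (p i : ℕ) : digitSet p i ⊆ Icc 0 1 := by
  rintro _ ⟨d, _, rfl⟩
  exact ⟨Real.ofDigits_nonneg d, Real.ofDigits_le_one d⟩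

theorem covBound_digitSet {p : ℕ} (hp : 0 < p) (i : ℕ) : CovBound (digitSet p i) (1 / p) := by
  classical
  refine ⟨1, 2 ^ p, one_pos, by positivity, fun δ h0 h1 => ?_⟩
  -- With `2 ^ (-p n)` comparable to `δ`, the first `p * n` places contain at most `n` free digits:
  -- `2 ^ n ≤ δ ^ (-1 / p)` centres, with error at most `2 ^ p * δ`.
  obtain ⟨n, hn1, hn2⟩ := exists_nat_pow_near_of_lt_one h0 h1
    (by positivity : (0 : ℝ) < ((2 : ℝ) ^ p)⁻¹)
    (inv_lt_one_of_one_lt₀ (one_lt_pow₀ one_lt_two hp.ne'))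
  refine ⟨Finset.univ.image fun f : Fin n → Fin 2 => Real.ofDigits fun k =>
    if h : k / p < n then (if k % p = i then f ⟨k / p, h⟩ else 0) else (0 : Fin 2), ?_, ?_⟩
  · refine le_trans (Nat.cast_le.2 Finset.card_image_le) ?_
    have e : ((((2 : ℝ) ^ p)⁻¹) ^ n) ^ (-(1 / p : ℝ)) = 2 ^ n := by
      rw [inv_pow, Real.inv_rpow (by positivity), ← Real.rpow_neg (by positivity), neg_neg,
        ← pow_mul, mul_comm, pow_mul, one_div, Real.pow_rpow_inv_natCast (by positivity) hp.ne']
    rw [one_mul, Finset.card_univ, Fintype.card_fun, Fintype.card_fin, Fintype.card_fin]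
    push_cast
    rw [← e]
    exact Real.rpow_le_rpow_of_nonpos h0 hn2 (by rw [neg_nonpos]; positivity)
  · rintro _ ⟨d, hd, rfl⟩
    refine ⟨_, Finset.mem_image_of_mem _ (Finset.mem_univ fun j : Fin n => d (p * j + i)), ?_⟩
    rw [Real.dist_eq]
    refine (Real.abs_ofDigits_sub_ofDigits_le (n := p * n) ?_).trans ?_
    · intro k hk
      rw [dif_pos (Nat.div_lt_of_lt_mul hk)]
      split_ifs with hki
      · simp only
        rw [← hki, Nat.div_add_mod]
      · exact hd k hki
    · rw [pow_succ, ← div_eq_mul_inv, div_lt_iff₀ (by positivity)] at hn1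
      push_cast
      rw [pow_mul, ← inv_pow, mul_comm]
      exact hn1.le

theorem exists_sum_digitSet {p : ℕ} (hp : 0 < p) {x : ℝ} (hx : x ∈ Icc (0 : ℝ) 1) :
    ∃ y : ℕ → ℝ, (∀ i, y i ∈ digitSet p i) ∧ x = ∑ i ∈ Finset.range p, y i := by
  obtain ⟨d, -, rfl⟩ := Real.ofDigits_SurjOn one_lt_two hx
  refine ⟨fun i => Real.ofDigits fun k => if k % p = i then d k else 0,
    fun i => ⟨_, fun k hk => if_neg hk, rfl⟩, ?_⟩
  simp only [Real.ofDigits]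
  rw [← Summable.tsum_finsetSum fun i _ => Real.summable_ofDigitsTerm]
  refine tsum_congr fun k => ?_
  rw [Finset.sum_eq_single (k % p)]
  · simp [Real.ofDigitsTerm]
  · intro j _ hj
    simp [Real.ofDigitsTerm, hj.symm]
  · intro h
    exact absurd (Finset.mem_range.2 (Nat.mod_lt k hp)) h

theorem CovBound.linear_combination {D D' : Set ℝ} {t s : ℝ} (hD : CovBound D t)
    (hD' : CovBound D' s) (α β γ : ℝ) :
    CovBound ((fun z : ℝ × ℝ => α * z.1 + β * z.2 + γ) '' (D ×ˢ D')) (t + s) := by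
  refine (hD.prod hD').image (L := |α| + |β|) _ fun z w => ?_
  have h1 : |z.1 - w.1| ≤ dist z w := le_max_left (dist z.1 w.1) (dist z.2 w.2)
  have h2 : |z.2 - w.2| ≤ dist z w := le_max_right (dist z.1 w.1) (dist z.2 w.2)
  calc dist (α * z.1 + β * z.2 + γ) (α * w.1 + β * w.2 + γ)
      = |α * (z.1 - w.1) + β * (z.2 - w.2)| := by
        rw [dist_add_right, Real.dist_eq]
        congr 1
        ring
    _ ≤ |α| * |z.1 - w.1| + |β| * |z.2 - w.2| := by
        rw [← abs_mul, ← abs_mul]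
        exact abs_add_le _ _
    _ ≤ |α| * dist z w + |β| * dist z w := by gcongr
    _ = _ := by ring

theorem minMinkowskiDim_horizontal_le {a b : ℝ} (hab : a < b) :
    minMinkowskiDim (segment ℝ ![a, 0 * a] ![b, 0 * b]) ≤ ((7 / 4 : ℝ) : EReal) := by
  have hD := fun i => covBound_digitSet (p := 3) (by norm_num) i
  -- Every coordinate set is built from two digit classes out of three, so its exponent is in fact
  -- `2 / 3`; it is relaxed to `3 / 4`.
  have ht : (1 / (3 : ℕ) + 1 / (3 : ℕ) : ℝ) ≤ 3 / 4 := by norm_num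
  have hX := (((hD 1).linear_combination (hD 2) 2 1 2).union
    ((hD 0).linear_combination (hD 2) 2 1 (-2))).mono_exponent ht
  have hY := (((hD 1).linear_combination (hD 0) 1 (-1) 2).union
    ((hD 1).linear_combination (hD 0) (-1) 1 (-2))).mono_exponent ht
  refine (minMinkowskiDim_segment_le_of_rescale (R := 3) hab (zero_lt_one' ℝ) (by norm_num) hX hY
    fun x hx => ?_).trans (by norm_num)
  obtain ⟨y, hy, rfl⟩ := exists_sum_digitSet (p := 3) (by norm_num) hx
  have h0 := digitSet_subset_Icc _ _ (hy 0)
  have h1 := digitSet_subset_Icc _ _ (hy 1)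
  simp only [Finset.sum_range_succ, Finset.sum_range_zero]
  -- With `x = y 0 + y 1 + y 2`, class 0 cancels in `x + r`, class 1 in `x - r`, and class 2 is
  -- absent from `r`. The shift by 2 makes `r` positive.
  refine ⟨y 1 - y 0 + 2, by linarith [h0.2, h1.1], by linarith [h0.1, h1.2],
    Or.inl ⟨(y 1, y 2), ⟨hy 1, hy 2⟩, ?_⟩, Or.inr ⟨(y 0, y 2), ⟨hy 0, hy 2⟩, ?_⟩,
    Or.inl ⟨(y 1, y 0), ⟨hy 1, hy 0⟩, ?_⟩, Or.inr ⟨(y 1, y 0), ⟨hy 1, hy 0⟩, ?_⟩⟩ <;>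
  · simp only
    ring

theorem minMinkowskiDim_diagonal_le {a b : ℝ} (hab : a < b) :
    minMinkowskiDim (segment ℝ ![a, 1 * a] ![b, 1 * b]) ≤ ((3 / 2 : ℝ) : EReal) := by
  have hD := fun i => covBound_digitSet (p := 2) (by norm_num) i
  have hlip : ∀ γ x y : ℝ, dist (2 * x + γ) (2 * y + γ) ≤ 2 * dist x y := fun γ x y => by
    rw [dist_add_right, Real.dist_eq, Real.dist_eq, ← mul_sub, abs_mul, abs_two]
  have hX := ((hD 0).image _ (hlip 2)).union ((hD 1).image _ (hlip (-2)))
  refine (minMinkowskiDim_segment_le_of_rescale (R := 3) hab (zero_lt_one' ℝ) (by norm_num) hX hX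
    fun x hx => ?_).trans (by norm_num)
  obtain ⟨y, hy, rfl⟩ := exists_sum_digitSet (p := 2) (by norm_num) hx
  have h0 := digitSet_subset_Icc _ _ (hy 0)
  have h1 := digitSet_subset_Icc _ _ (hy 1)
  simp only [Finset.sum_range_succ, Finset.sum_range_zero]
  -- Here `x + r = 2 * y 0 + 2` and `x - r = 2 * y 1 - 2`: one digit class each, serving both
  -- abscissae and ordinates.
  refine ⟨y 0 - y 1 + 2, by linarith [h0.1, h1.2], by linarith [h0.2, h1.1],
    Or.inl ⟨y 0, hy 0, ?_⟩, Or.inr ⟨y 1, hy 1, ?_⟩,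
    Or.inl ⟨y 0, hy 0, ?_⟩, Or.inr ⟨y 1, hy 1, ?_⟩⟩ <;>
  · simp only
    ring

/-! ### Packing lower bounds and conclusion. -/

theorem le_minPackingDim_horizontal {a b : ℝ} (hab : a < b) :
    ((17 / 11 : ℝ) : EReal) ≤ minPackingDim (segment ℝ ![a, 0 * a] ![b, 0 * b]) := by
  refine le_iInf₂ fun B hB => le_of_not_gt fun hlt => ?_
  obtain ⟨s, hs, hs'⟩ := EReal.lt_iff_exists_real_btwn.1 hlt
  obtain ⟨U, V, W, hU, hV, hW, p, q, R, hpq, h⟩ := exists_side_sets_of_packingDim_lt hab hB hs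
  have := six_div_eleven_le_of_covBound hpq hU hV hW fun x hx => by
    obtain ⟨r, _, _, h1, h2, h3⟩ := h x hx
    exact ⟨r, h1, h2, by simpa using h3⟩
  have hs' : s < 17 / 11 := by exact_mod_cast hs'
  linarith

theorem le_minPackingDim_diagonal {a b : ℝ} (hab : a < b) :
    ((3 / 2 : ℝ) : EReal) ≤ minPackingDim (segment ℝ ![a, 1 * a] ![b, 1 * b]) := by
  refine le_iInf₂ fun B hB => le_of_not_gt fun hlt => ?_
  obtain ⟨s, hs, hs'⟩ := EReal.lt_iff_exists_real_btwn.1 hlt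
  obtain ⟨U, V, W, hU, hV, -, p, q, R, hpq, h⟩ := exists_side_sets_of_packingDim_lt hab hB hs
  have := half_le_of_covBound hpq hU hV fun x hx => by
    obtain ⟨r, _, _, h1, h2, _⟩ := h x hx
    exact ⟨r, h1, h2⟩
  have hs' : s < 3 / 2 := by exact_mod_cast hs'
  linarith

/-- The two segments are unrelated: this yields both the equality of the two minima and their
independence of the segment. -/
theorem minMinkowskiDim_horizontal_le_minPackingDim {a b a' b' : ℝ} (hab : a < b)
    (hab' : a' < b') :
    minMinkowskiDim (segment ℝ ![a, 0 * a] ![b, 0 * b]) ≤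
      minPackingDim (segment ℝ ![a', 0 * a'] ![b', 0 * b']) := by
  refine le_iInf₂ fun B hB => EReal.le_of_forall_lt_iff_le.1 fun s hs => ?_
  obtain ⟨U, V, W, hU, hV, hW, p, q, R, hpq, h⟩ := exists_side_sets_of_packingDim_lt hab' hB hs
  -- Needed only for `0 ≤ s - 1`.
  have h6 := six_div_eleven_le_of_covBound hpq hU hV hW fun x hx => by
    obtain ⟨r, _, _, h1, h2, h3⟩ := h x hx
    exact ⟨r, h1, h2, by simpa using h3⟩
  -- On the axis the lower side has ordinate `-r`, so `W` together with its reflection serves both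
  -- horizontal sides.
  have := minMinkowskiDim_segment_le_of_rescale (c := 0) (R := R) hab hpq (by linarith)
    (hU.union hV) (hW.union hW.neg) fun x hx => by
      obtain ⟨r, hr, hrR, h1, h2, h3⟩ := h x hx
      rw [zero_mul, zero_add] at h3
      exact ⟨r, hr, hrR, Or.inl h1, Or.inr h2, Or.inl (by simpa using h3),
        Or.inr ⟨r, h3, by simp⟩⟩
  simpa using this

theorem mainTheorem11 :
    (∃ h : ℝ, 17 / 11 ≤ h ∧ h ≤ 7 / 4 ∧ ∀ a b : ℝ, a < b →
      minMinkowskiDim (segment ℝ ![a, 0] ![b, 0]) = (h : EReal) ∧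
      minPackingDim (segment ℝ ![a, 0] ![b, 0]) = (h : EReal)) ∧
    (∀ a b : ℝ, a < b →
      minMinkowskiDim (segment ℝ ![a, a] ![b, b]) = ((3 / 2 : ℝ) : EReal) ∧
      minPackingDim (segment ℝ ![a, a] ![b, b]) = ((3 / 2 : ℝ) : EReal)) := by
  constructor
  · have hlow := le_minPackingDim_horizontal (zero_lt_one' ℝ)
    have hle := minPackingDim_le_minMinkowskiDim (segment ℝ ![(0 : ℝ), 0 * 0] ![1, 0 * 1])
    have hup := hle.trans (minMinkowskiDim_horizontal_le (zero_lt_one' ℝ))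
    -- The number `h` is the packing value of the unit segment, real because it lies between the two
    -- bounds.
    set H := minPackingDim (segment ℝ ![(0 : ℝ), 0 * 0] ![1, 0 * 1]) with hH
    lift H to ℝ using ⟨ne_top_of_le_ne_top (EReal.coe_ne_top _) hup,
      ne_bot_of_le_ne_bot (EReal.coe_ne_bot _) hlow⟩ with h
    refine ⟨h, by exact_mod_cast hlow, by exact_mod_cast hup, fun a b hab => ?_⟩
    have h1 := minMinkowskiDim_horizontal_le_minPackingDim hab (zero_lt_one' ℝ)
    have h2 := (minPackingDim_le_minMinkowskiDim _).trans
      (minMinkowskiDim_horizontal_le_minPackingDim (zero_lt_one' ℝ) hab)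
    rw [← hH] at h1 h2
    have h3 := minPackingDim_le_minMinkowskiDim (segment ℝ ![a, 0 * a] ![b, 0 * b])
    simp only [zero_mul] at h1 h2 h3
    exact ⟨le_antisymm h1 (h2.trans h3), le_antisymm (h3.trans h1) h2⟩
  · intro a b hab
    have h1 := minMinkowskiDim_diagonal_le hab
    have h2 := le_minPackingDim_diagonal hab
    have h3 := minPackingDim_le_minMinkowskiDim (segment ℝ ![a, 1 * a] ![b, 1 * b])
    simp only [one_mul] at h1 h2 h3
    exact ⟨le_antisymm h1 (h2.trans h3), le_antisymm (h3.trans h1) h2⟩
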